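/- Let $[a,b]\subset\mathbb{R}$ be a finite interval with $a<b$, let $n\in\mathbb{N}\cup\{0\}$, let $m,r,l\ge 1$ be integers, and let $1\le p\le\infty$. For $k\ge 1$ let $W_p^{k}=W_p^{k}([a,b];\mathbb{C})$ be the Sobolev space of all $y\in C^{k-1}([a,b];\mathbb{C})$ such that $y^{(k-1)}$ is absolutely continuous and $y^{(k)}\in L_p$; put $W_p^0=L_p([a,b];\mathbb{C})$. These spaces are normed by $\|y\|_{k,p}=\sum_{j=0}^{k}\|y^{(j)}\|_p$, and spaces of vector- or matrix-valued functions by the sum of the norms of the entries. Let $A_0,\dots,A_{r-1}\in (W_p^n)^{m\times m}$, put $$(Ly)(t)=y^{(r)}(t)+\sum_{j=1}^{r}A_{r-j}(t)\,y^{(r-j)}(t),\qquad y\in (W_p^{n+r})^m,$$ let $B\colon (W_p^{n+r})^m\to\mathbb{C}^l$ be an arbitrary continuous linear operator, and consider the linear operator $$(L,B)\colon (W_p^{n+r})^m\to (W_p^{n})^m\times\mathbb{C}^l,\qquad y\mapsto (Ly,By).$$ Then for each $i\in\{1,\dots,r\}$ the matrix Cauchy problem $$Y_i^{(r)}(t)+\sum_{j=1}^{r}A_{r-j}(t)\,Y_i^{(r-j)}(t)=0,\quad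 t\in(a,b),\qquad Y_i^{(j-1)}(a)=\delta_{i,j}I_m,\quad j\in\{1,\dots,r\},$$ (the equation being understood almost everywhere if $n=0$) has a unique solution $Y_i\in (W_p^{n+r})^{m\times m}$. Let $[BY_i]\in\mathbb{C}^{l\times m}$ be the matrix whose $j$-th column is the value of $B$ on the $j$-th column of $Y_i$, and let $$M(L,B)=\bigl([BY_1],\dots,[BY_r]\bigr)\in\mathbb{C}^{l\times rm}$$ be the characteristic matrix. The operator $(L,B)$ is invertible (that is, bounded and bijective with bounded inverse) if and only if $l=rm$ and the square matrix $M(L,B)$ is nonsingular. -/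

import Mathlib

open MeasureTheory Set
open scoped ENNReal

noncomputable section

namespace SobolevBVP

/-! ### Sobolev functions on a compact interval -/

/-- Lebesgue measure on `[a, b]`. -/
abbrev vol (a b : ℝ) : Measure ℝ := volume.restrict (Icc a b)

/-- `MemW a b p k y` says that the restriction of `y` to `[a, b]` is a (representative of a)
function of the complex Sobolev space `W_p^k([a, b]; ℂ)`: for `k = 0` this is `L_p`; for `k ≥ 1`
it means that `y ∈ C^{k-1}[a, b]`, that `y^{(k-1)}` is absolutely continuous on `[a, b]`, and that
`y^{(k)} ∈ L_p`. All derivatives are taken within `[a, b]` (one-sided at the end points), so that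
only the values of `y` on `[a, b]` matter. -/
def MemW (a b : ℝ) (p : ℝ≥0∞) : ℕ → (ℝ → ℂ) → Prop
  | 0, y => MemLp y p (vol a b)
  | k + 1, y =>
      ContDiffOn ℝ k y (Icc a b) ∧
      AbsolutelyContinuousOnInterval (iteratedDerivWithin k y (Icc a b)) a b ∧
      MemLp (iteratedDerivWithin (k + 1) y (Icc a b)) p (vol a b)

section Basic

variable {a b : ℝ} {p : ℝ≥0∞} {k : ℕ} {f g : ℝ → ℂ}

theorem ac_congr (hab : a < b) (hf : AbsolutelyContinuousOnInterval f a b)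
    (h : EqOn f g (Icc a b)) : AbsolutelyContinuousOnInterval g a b := by
  rw [absolutelyContinuousOnInterval_iff] at hf ⊢
  intro ε hε
  obtain ⟨δ, hδ, H⟩ := hf ε hε
  refine ⟨δ, hδ, fun E hE hs => ?_⟩
  refine lt_of_eq_of_lt (Finset.sum_congr rfl fun i hi => ?_) (H E hE hs)
  have := hE.1 i hi
  rw [uIcc_of_le hab.le] at this
  rw [h this.1, h this.2]

theorem ac_ae_diff (hab : a < b) (hf : AbsolutelyContinuousOnInterval f a b) :
    ∀ᵐ t ∂(vol a b), DifferentiableWithinAt ℝ f (Icc a b) t := by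
  have := hf.boundedVariationOn
  rw [uIcc_of_le hab.le] at this
  exact this.locallyBoundedVariationOn.ae_differentiableWithinAt measurableSet_Icc

theorem ac_continuousOn (hab : a < b) (hf : AbsolutelyContinuousOnInterval f a b) :
    ContinuousOn f (Icc a b) := by
  have := hf.continuousOn
  rwa [uIcc_of_le hab.le] at this

theorem memLp_of_continuousOn (hf : ContinuousOn f (Icc a b)) (p : ℝ≥0∞) :
    MemLp f p (vol a b) := by
  obtain ⟨C, hC⟩ := isCompact_Icc.exists_bound_of_continuousOn hf
  exact MemLp.of_bound (hf.aestronglyMeasurable measurableSet_Icc) C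
    ((ae_restrict_iff' measurableSet_Icc).2 (Filter.Eventually.of_forall hC))

theorem ae_of_eqOn (h : EqOn f g (Icc a b)) : f =ᵐ[vol a b] g :=
  (ae_restrict_iff' measurableSet_Icc).2 (Filter.Eventually.of_forall h)

theorem memW_one (hab : a < b) : MemW a b p 1 f ↔
    AbsolutelyContinuousOnInterval f a b ∧ MemLp (derivWithin f (Icc a b)) p (vol a b) := by
  simp only [MemW, zero_add, iteratedDerivWithin_zero, iteratedDerivWithin_one, Nat.cast_zero,
    contDiffOn_zero]
  exact ⟨fun h => h.2, fun h => ⟨ac_continuousOn hab h.1, h⟩⟩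

theorem memW_succ (hab : a < b) : MemW a b p (k + 2) f ↔
    DifferentiableOn ℝ f (Icc a b) ∧ MemW a b p (k + 1) (derivWithin f (Icc a b)) := by
  have hu := uniqueDiffOn_Icc hab
  have h1 : ContDiffOn ℝ ((k + 1 : ℕ) : WithTop ℕ∞) f (Icc a b) ↔
      DifferentiableOn ℝ f (Icc a b) ∧ ContDiffOn ℝ k (derivWithin f (Icc a b)) (Icc a b) := by
    rw [Nat.cast_succ, contDiffOn_succ_iff_derivWithin hu]
    simp
  simp only [MemW, h1, ← iteratedDerivWithin_succ', and_assoc]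

theorem memW_deriv (hab : a < b) (hf : MemW a b p (k + 1) f) :
    MemW a b p k (derivWithin f (Icc a b)) := by
  cases k with
  | zero => exact ((memW_one hab).1 hf).2
  | succ k => exact ((memW_succ hab).1 hf).2

theorem memW_iter (hab : a < b) (s : ℕ) (hf : MemW a b p (k + s) f) :
    MemW a b p k (iteratedDerivWithin s f (Icc a b)) := by
  induction s generalizing f with
  | zero => simpa using hf
  | succ s ih =>
    rw [iteratedDerivWithin_succ']
    exact ih (memW_deriv hab hf)

theorem memW_continuousOn (hf : MemW a b p (k + 1) f) : ContinuousOn f (Icc a b) :=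
  hf.1.continuousOn

theorem memW_ac (hab : a < b) (hf : MemW a b p (k + 1) f) :
    AbsolutelyContinuousOnInterval f a b := by
  cases k with
  | zero => exact ((memW_one hab).1 hf).1
  | succ k =>
    apply ContDiffOn.absolutelyContinuousOnInterval
    rw [uIcc_of_le hab.le]
    exact hf.1.of_le (by norm_cast; omega)

theorem memW_of_succ (hab : a < b) (hf : MemW a b p (k + 1) f) : MemW a b p k f := by
  induction k generalizing f with
  | zero => exact memLp_of_continuousOn (memW_continuousOn hf) p
  | succ k ih =>
    obtain ⟨hd, h⟩ := (memW_succ hab).1 hf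
    cases k with
    | zero =>
      exact (memW_one hab).2 ⟨memW_ac hab hf, memLp_of_continuousOn (memW_continuousOn h) p⟩
    | succ k => exact (memW_succ hab).2 ⟨hd, ih h⟩

theorem memW_mono (hab : a < b) {j : ℕ} (hjk : j ≤ k) (hf : MemW a b p k f) :
    MemW a b p j f := by
  induction hjk with
  | refl => exact hf
  | step _ ih => exact ih (memW_of_succ hab hf)

theorem memW_congr (hab : a < b) (hf : MemW a b p k f) (h : EqOn f g (Icc a b)) :
    MemW a b p k g := by
  cases k with
  | zero => exact (memLp_congr_ae (ae_of_eqOn h)).1 hf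
  | succ k =>
    exact ⟨hf.1.congr fun x hx => (h hx).symm, ac_congr hab hf.2.1 (iteratedDerivWithin_congr h),
      (memLp_congr_ae (ae_of_eqOn (iteratedDerivWithin_congr h))).1 hf.2.2⟩

theorem memW_add (hab : a < b) (hf : MemW a b p k f) (hg : MemW a b p k g) :
    MemW a b p k (f + g) := by
  induction k generalizing f g with
  | zero => exact MemLp.add hf hg
  | succ k ih =>
    cases k with
    | zero =>
      rw [memW_one hab] at hf hg ⊢
      refine ⟨hf.1.add hg.1, (memLp_congr_ae ?_).1 (hf.2.add hg.2)⟩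
      filter_upwards [ac_ae_diff hab hf.1, ac_ae_diff hab hg.1] with t h1 h2
      simp [derivWithin_add h1 h2]
    | succ k =>
      rw [memW_succ hab] at hf hg ⊢
      refine ⟨hf.1.add hg.1, memW_congr hab (ih hf.2 hg.2) fun t ht => ?_⟩
      simp [derivWithin_add (hf.1 t ht) (hg.1 t ht)]

theorem memW_smul (c : ℂ) (hf : MemW a b p k f) : MemW a b p k (c • f) := by
  have h (j : ℕ) : iteratedDerivWithin j (c • f) (Icc a b) =
      c • iteratedDerivWithin j f (Icc a b) := by
    ext t
    simp [iteratedDerivWithin_const_smul_field]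
  cases k with
  | zero => exact MemLp.const_smul hf c
  | succ k =>
    refine ⟨hf.1.const_smul c, ?_, ?_⟩
    · rw [h]
      exact hf.2.1.const_smul c
    · rw [h]
      exact hf.2.2.const_smul c

theorem memW_zero : MemW a b p k 0 := by
  have h (j : ℕ) : iteratedDerivWithin j (0 : ℝ → ℂ) (Icc a b) = 0 := by
    ext t
    simp
  cases k with
  | zero => exact MemLp.zero
  | succ k =>
    refine ⟨contDiffOn_const, ?_, ?_⟩
    · rw [h]
      exact (contDiffOn_const (c := (0 : ℂ))).absolutelyContinuousOnInterval
    · rw [h]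
      exact MemLp.zero

theorem memW_sum (hab : a < b) {ι : Type*} (s : Finset ι) (F : ι → ℝ → ℂ)
    (hF : ∀ i ∈ s, MemW a b p k (F i)) : MemW a b p k (∑ i ∈ s, F i) := by
  classical
  induction s using Finset.induction_on with
  | empty => simpa using memW_zero
  | insert i s hi ih =>
    rw [Finset.sum_insert hi]
    exact memW_add hab (hF i (by simp)) (ih fun j hj => hF j (by simp [hj]))

theorem memLp_mul_continuousOn (hf : MemLp f p (vol a b)) (hg : ContinuousOn g (Icc a b)) :
    MemLp (f * g) p (vol a b) := by
  have hg' := memLp_of_continuousOn hg ∞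
  have := MemLp.mul (r := p) hg' hf
  exact this

theorem memW_mul_self (hab : a < b) (hf : MemW a b p (k + 1) f) (hg : MemW a b p (k + 1) g) :
    MemW a b p (k + 1) (f * g) := by
  induction k generalizing f g with
  | zero =>
    have hfc := memW_continuousOn hf
    have hgc := memW_continuousOn hg
    rw [memW_one hab] at hf hg ⊢
    refine ⟨hf.1.smul hg.1, (memLp_congr_ae ?_).1
      ((memLp_mul_continuousOn hf.2 hgc).add (memLp_mul_continuousOn hg.2 hfc))⟩
    filter_upwards [ac_ae_diff hab hf.1, ac_ae_diff hab hg.1] with t h1 h2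
    simp [derivWithin_mul h1 h2, mul_comm]
  | succ k ih =>
    have hf1 := memW_of_succ hab hf
    have hg1 := memW_of_succ hab hg
    rw [memW_succ hab] at hf hg ⊢
    refine ⟨hf.1.mul hg.1,
      memW_congr hab (memW_add hab (ih hf.2 hg1) (ih hf1 hg.2)) fun t ht => ?_⟩
    simp [derivWithin_mul (hf.1 t ht) (hg.1 t ht)]

theorem memW_mul (hab : a < b) (hf : MemW a b p k f) (hg : MemW a b p (k + 1) g) :
    MemW a b p k (f * g) := by
  cases k with
  | zero => exact memLp_mul_continuousOn hf (memW_continuousOn hg)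
  | succ k => exact memW_mul_self hab hf (memW_of_succ hab hg)

theorem memW_iter_memLp (hab : a < b) {j : ℕ} (hj : j ≤ k) (hf : MemW a b p k f) :
    MemLp (iteratedDerivWithin j f (Icc a b)) p (vol a b) :=
  memW_iter (k := 0) hab j (memW_mono hab (by omega) hf)

theorem ae_iter_add (hab : a < b) {j : ℕ} (hj : j ≤ k)
    (hf : MemW a b p k f) (hg : MemW a b p k g) :
    iteratedDerivWithin j (f + g) (Icc a b) =ᵐ[vol a b]
      iteratedDerivWithin j f (Icc a b) + iteratedDerivWithin j g (Icc a b) := by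
  induction j generalizing k f g with
  | zero => simp
  | succ j ih =>
    obtain ⟨k, rfl⟩ : ∃ k', k = k' + 1 := ⟨k - 1, by omega⟩
    cases k with
    | zero =>
      obtain rfl : j = 0 := by omega
      rw [memW_one hab] at hf hg
      filter_upwards [ac_ae_diff hab hf.1, ac_ae_diff hab hg.1] with t h1 h2
      simp [derivWithin_add h1 h2]
    | succ k =>
      rw [memW_succ hab] at hf hg
      simp only [iteratedDerivWithin_succ']
      refine Filter.EventuallyEq.trans (ae_of_eqOn (iteratedDerivWithin_congr fun t ht => ?_))
        (ih (k := k + 1) (by omega) hf.2 hg.2)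
      simp [derivWithin_add (hf.1 t ht) (hg.1 t ht)]

theorem ae_iter_of_ae (hab : a < b) {j : ℕ} (hj : j ≤ k)
    (hf : MemW a b p k f) (hg : MemW a b p k g) (h : f =ᵐ[vol a b] g) :
    iteratedDerivWithin j f (Icc a b) =ᵐ[vol a b] iteratedDerivWithin j g (Icc a b) := by
  cases k with
  | zero =>
    obtain rfl : j = 0 := by omega
    simpa using h
  | succ k =>
    exact ae_of_eqOn (iteratedDerivWithin_congr (Measure.eqOn_Icc_of_ae_eq volume hab.ne h
      (memW_continuousOn hf) (memW_continuousOn hg)))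

end Basic

/-! ### The Sobolev spaces as Banach spaces -/

/-- The space `W_p^k([a, b]; ℂ)` as a space of families of derivatives. A function `y` of this space is stored as the family
`(y, y', …, y^{(k)})` of its derivatives, each taken as an element of `L_p`. The norm inherited
from the `ℓ¹`-sum of `k + 1` copies of `L_p` is `∑_{j ≤ k} ‖y^{(j)}‖_p`. -/
def WSub (a b : ℝ) [hab : Fact (a < b)] (p : ℝ≥0∞) [Fact (1 ≤ p)] (k : ℕ) :
    Submodule ℂ (PiLp 1 fun _ : Fin (k + 1) => Lp ℂ p (vol a b)) where
  carrier := {u | ∃ y : ℝ → ℂ, MemW a b p k y ∧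
    ∀ j : Fin (k + 1), u j =ᵐ[vol a b] iteratedDerivWithin j y (Icc a b)}
  zero_mem' := by
    refine ⟨0, memW_zero, fun j => ?_⟩
    filter_upwards [Lp.coeFn_zero ℂ p (vol a b)] with t ht
    simpa using ht
  add_mem' := by
    rintro u v ⟨y, hy, hu⟩ ⟨z, hz, hv⟩
    refine ⟨y + z, memW_add hab.out hy hz, fun j => ?_⟩
    filter_upwards [Lp.coeFn_add (u j) (v j), hu j, hv j,
      ae_iter_add hab.out (Nat.lt_succ_iff.1 j.2) hy hz] with t h1 h2 h3 h4
    simp only [PiLp.add_apply, h1, h4, Pi.add_apply, h2, h3]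
  smul_mem' := by
    rintro c u ⟨y, hy, hu⟩
    refine ⟨c • y, memW_smul c hy, fun j => ?_⟩
    filter_upwards [Lp.coeFn_smul c (u j), hu j] with t h1 h2
    simp only [PiLp.smul_apply, h1, Pi.smul_apply, h2, iteratedDerivWithin_const_smul_field]

/-- The normed space `W_p^k([a, b]; ℂ)`. -/
def W (a b : ℝ) [Fact (a < b)] (p : ℝ≥0∞) [Fact (1 ≤ p)] (k : ℕ) : Type := WSub a b p k

instance (a b : ℝ) [Fact (a < b)] (p : ℝ≥0∞) [Fact (1 ≤ p)] (k : ℕ) :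
    NormedAddCommGroup (W a b p k) :=
  inferInstanceAs (NormedAddCommGroup (WSub a b p k))

instance (a b : ℝ) [Fact (a < b)] (p : ℝ≥0∞) [Fact (1 ≤ p)] (k : ℕ) :
    NormedSpace ℂ (W a b p k) :=
  inferInstanceAs (NormedSpace ℂ (WSub a b p k))

section Space

variable {a b : ℝ} [hab : Fact (a < b)] {p : ℝ≥0∞} [Fact (1 ≤ p)] {k : ℕ}

/-- A function representing the element `u` of `W_p^k`. On `[a, b]` it is unique if `k ≥ 1`
(being continuous there), and unique up to a null set if `k = 0`. -/
def rep (u : W a b p k) : ℝ → ℂ := Classical.choose u.2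

theorem rep_mem (u : W a b p k) : MemW a b p k (rep u) := (Classical.choose_spec u.2).1

theorem rep_ae (u : W a b p k) (j : Fin (k + 1)) :
    u.1 j =ᵐ[vol a b] iteratedDerivWithin j (rep u) (Icc a b) :=
  (Classical.choose_spec u.2).2 j

/-- The family `(y, y', …, y^{(k)})` of elements of `L_p`. -/
def jet (y : ℝ → ℂ) (hy : MemW a b p k y) : PiLp 1 fun _ : Fin (k + 1) => Lp ℂ p (vol a b) :=
  WithLp.toLp 1 fun j => MemLp.toLp (iteratedDerivWithin j y (Icc a b))
    (memW_iter_memLp hab.out (Nat.lt_succ_iff.1 j.2) hy)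

theorem jet_ae (y : ℝ → ℂ) (hy : MemW a b p k y) (j : Fin (k + 1)) :
    jet y hy j =ᵐ[vol a b] iteratedDerivWithin j y (Icc a b) :=
  MemLp.coeFn_toLp (memW_iter_memLp hab.out (Nat.lt_succ_iff.1 j.2) hy)

/-- The element of `W_p^k` given by a function with the property `MemW`. -/
def toW (y : ℝ → ℂ) (hy : MemW a b p k y) : W a b p k := ⟨jet y hy, y, hy, jet_ae y hy⟩

theorem rep_toW (y : ℝ → ℂ) (hy : MemW a b p k y) : rep (toW y hy) =ᵐ[vol a b] y := by
  simpa using (rep_ae (toW y hy) 0).symm.trans (jet_ae y hy 0)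

theorem W_ext {u v : W a b p k} (h : rep u =ᵐ[vol a b] rep v) : u = v := by
  refine Subtype.ext (PiLp.ext fun j => Lp.ext ?_)
  exact (rep_ae u j).trans ((ae_iter_of_ae hab.out (Nat.lt_succ_iff.1 j.2) (rep_mem u) (rep_mem v)
    h).trans (rep_ae v j).symm)

theorem rep_add (u v : W a b p k) {j : ℕ} (hj : j ≤ k) :
    iteratedDerivWithin j (rep (u + v)) (Icc a b) =ᵐ[vol a b]
      iteratedDerivWithin j (rep u) (Icc a b) + iteratedDerivWithin j (rep v) (Icc a b) := by
  have hj' := Nat.lt_succ_of_le hj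
  filter_upwards [rep_ae (u + v) ⟨j, hj'⟩, rep_ae u ⟨j, hj'⟩, rep_ae v ⟨j, hj'⟩,
    Lp.coeFn_add (u.1 ⟨j, hj'⟩) (v.1 ⟨j, hj'⟩)] with t h1 h2 h3 h4
  rw [Pi.add_apply, ← h1, ← h2, ← h3]
  exact h4

theorem rep_smul (c : ℂ) (u : W a b p k) {j : ℕ} (hj : j ≤ k) :
    iteratedDerivWithin j (rep (c • u)) (Icc a b) =ᵐ[vol a b]
      c • iteratedDerivWithin j (rep u) (Icc a b) := by
  have hj' := Nat.lt_succ_of_le hj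
  filter_upwards [rep_ae (c • u) ⟨j, hj'⟩, rep_ae u ⟨j, hj'⟩,
    Lp.coeFn_smul c (u.1 ⟨j, hj'⟩)] with t h1 h2 h3
  rw [Pi.smul_apply, ← h1, ← h2]
  exact h3

end Space

/-- The space `(W_p^k)^m = W_p^k([a, b]; ℂ^m)`, normed by the sum of the norms of the
components. -/
abbrev WVec (a b : ℝ) [Fact (a < b)] (p : ℝ≥0∞) [Fact (1 ≤ p)] (k m : ℕ) : Type :=
  PiLp 1 fun _ : Fin m => W a b p k

/-! ### The boundary-value problem -/

section Problem

variable {a b : ℝ} [hab : Fact (a < b)] {p : ℝ≥0∞} [Fact (1 ≤ p)] {n m r l : ℕ}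

/-- The `i`-th component of `y^{(r)}(t) + ∑_{s = 0}^{r - 1} A_s(t) y^{(s)}(t)`. -/
def diffFun (A : Fin r → Matrix (Fin m) (Fin m) (W a b p n)) (y : WVec a b p (n + r) m)
    (i : Fin m) (t : ℝ) : ℂ :=
  iteratedDerivWithin r (rep (y i)) (Icc a b) t +
    ∑ s : Fin r, ∑ d : Fin m,
      rep (A s i d) t * iteratedDerivWithin s (rep (y d)) (Icc a b) t

theorem diffFun_mem (A : Fin r → Matrix (Fin m) (Fin m) (W a b p n)) (y : WVec a b p (n + r) m)
    (i : Fin m) : MemW a b p n (diffFun A y i) := by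
  have h : diffFun A y i = iteratedDerivWithin r (rep (y i)) (Icc a b) +
      ∑ s : Fin r, ∑ d : Fin m,
        rep (A s i d) * iteratedDerivWithin s (rep (y d)) (Icc a b) := by
    ext t
    simp [diffFun, Finset.sum_apply]
  rw [h]
  refine memW_add hab.out (memW_iter hab.out r (rep_mem _)) (memW_sum hab.out _ _ fun s _ =>
    memW_sum hab.out _ _ fun d _ => memW_mul hab.out (rep_mem _) (memW_iter hab.out s ?_))
  exact memW_mono hab.out (by omega) (rep_mem (y d))

/-- The differential operator `L : (W_p^{n+r})^m → (W_p^n)^m`,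
`(L y)(t) = y^{(r)}(t) + ∑_{s = 0}^{r - 1} A_s(t) y^{(s)}(t)`. -/
def diffOp (A : Fin r → Matrix (Fin m) (Fin m) (W a b p n)) :
    WVec a b p (n + r) m →ₗ[ℂ] WVec a b p n m where
  toFun y := WithLp.toLp 1 fun i => toW (diffFun A y i) (diffFun_mem A y i)
  map_add' y z := by
    refine PiLp.ext fun i => W_ext ?_
    have h1 : ∀ᵐ t ∂(vol a b), ∀ s : Fin (r + 1), ∀ d : Fin m,
        iteratedDerivWithin s (rep ((y + z) d)) (Icc a b) t =
          iteratedDerivWithin s (rep (y d)) (Icc a b) t +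
            iteratedDerivWithin s (rep (z d)) (Icc a b) t :=
      ae_all_iff.2 fun s => ae_all_iff.2 fun d => rep_add (y d) (z d) (by omega)
    have h2 := rep_add (toW (diffFun A y i) (diffFun_mem A y i))
      (toW (diffFun A z i) (diffFun_mem A z i)) (j := 0) (by omega)
    simp only [iteratedDerivWithin_zero] at h2
    refine (rep_toW _ _).trans (Filter.EventuallyEq.trans ?_ h2.symm)
    filter_upwards [h1, rep_toW (diffFun A y i) (diffFun_mem A y i),
      rep_toW (diffFun A z i) (diffFun_mem A z i)] with t h h3 h4
    rw [Pi.add_apply, h3, h4]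
    have hr := h (Fin.last r) i
    have hs (s : Fin r) (d : Fin m) := h s.castSucc d
    simp only [Fin.val_last] at hr
    simp only [Fin.val_castSucc] at hs
    simp only [diffFun, hr, hs, mul_add, Finset.sum_add_distrib]
    ring
  map_smul' c y := by
    refine PiLp.ext fun i => W_ext ?_
    have h1 : ∀ᵐ t ∂(vol a b), ∀ s : Fin (r + 1), ∀ d : Fin m,
        iteratedDerivWithin s (rep ((c • y) d)) (Icc a b) t =
          c * iteratedDerivWithin s (rep (y d)) (Icc a b) t :=
      ae_all_iff.2 fun s => ae_all_iff.2 fun d => rep_smul c (y d) (by omega)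
    have h2 := rep_smul c (toW (diffFun A y i) (diffFun_mem A y i)) (j := 0) (by omega)
    simp only [iteratedDerivWithin_zero] at h2
    refine (rep_toW _ _).trans (Filter.EventuallyEq.trans ?_ h2.symm)
    filter_upwards [h1, rep_toW (diffFun A y i) (diffFun_mem A y i)] with t h h3
    rw [Pi.smul_apply, h3]
    have hr := h (Fin.last r) i
    have hs (s : Fin r) (d : Fin m) := h s.castSucc d
    simp only [Fin.val_last] at hr
    simp only [Fin.val_castSucc] at hs
    simp only [diffFun, hr, hs, mul_left_comm _ c, ← Finset.mul_sum, smul_eq_mul, mul_add]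

/-- The operator `(L, B) : (W_p^{n+r})^m → (W_p^n)^m × ℂ^l`, `y ↦ (L y, B y)`. -/
def bvpOp (A : Fin r → Matrix (Fin m) (Fin m) (W a b p n))
    (B : WVec a b p (n + r) m →L[ℂ] (Fin l → ℂ)) :
    WVec a b p (n + r) m →ₗ[ℂ] WVec a b p n m × (Fin l → ℂ) :=
  (diffOp A).prod B.toLinearMap

/-- A linear operator between normed spaces is invertible if it is bounded and bijective with
bounded inverse. -/
def IsInvertibleOp {E F : Type*} [NormedAddCommGroup E] [NormedSpace ℂ E]
    [NormedAddCommGroup F] [NormedSpace ℂ F] (T : E →ₗ[ℂ] F) : Prop :=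
  ∃ e : E ≃L[ℂ] F, ∀ x, e x = T x

/-- The `d`-th column of a matrix-valued function of class `W_p^k`. -/
def column {k : ℕ} (Y : Matrix (Fin m) (Fin m) (W a b p k)) (d : Fin m) : WVec a b p k m :=
  WithLp.toLp 1 fun i => Y i d

/-- `Y = (Y_0, …, Y_{r-1})` are the solutions in `(W_p^{n+r})^{m×m}` to the `r` matrix Cauchy
problems `L Y_i = 0` on `(a, b)` (column by column) and `Y_i^{(j)}(a) = δ_{ij} I_m` for
`0 ≤ j ≤ r - 1`. -/
def IsCauchyFamily (A : Fin r → Matrix (Fin m) (Fin m) (W a b p n))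
    (Y : Fin r → Matrix (Fin m) (Fin m) (W a b p (n + r))) : Prop :=
  ∀ i : Fin r,
    (∀ d : Fin m, diffOp A (column (Y i) d) = 0) ∧
    ∀ j : Fin r, Matrix.of (fun c d : Fin m =>
      iteratedDerivWithin j (rep (Y i c d)) (Icc a b) a) = if i = j then 1 else 0

/-- The block matrix `([B Y_0], …, [B Y_{r-1}]) ∈ ℂ^{l × rm}`, where the `d`-th column of the
`l × m` block `[B Y_i]` is the value of `B` on the `d`-th column of `Y_i`. The bijection
`finProdFinEquiv` sends `(i, d)` to `i * m + d`. -/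
def charMatrix (B : WVec a b p (n + r) m →L[ℂ] (Fin l → ℂ))
    (Y : Fin r → Matrix (Fin m) (Fin m) (W a b p (n + r))) :
    Matrix (Fin l) (Fin (r * m)) ℂ :=
  Matrix.of fun q x =>
    B (column (Y (finProdFinEquiv.symm x).1) (finProdFinEquiv.symm x).2) q

end Problem

end SobolevBVP

end

/-!
The key fact is that the Cauchy problem is well posed in Sobolev spaces: the operator
`y ↦ (L y, (y(a), y'(a), …, y^{(r-1)}(a)))` is a bijection of `(W_p^{n+r})^m` onto
`(W_p^n)^m × ℂ^{rm}` (`bijective_diffOp_prod_initialTrace`). Writing `L y = f` as a first-order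
system for `(y, y', …, y^{(r-1)})` turns it into an integral equation
`x(t) = c + ∫_a^t G(s, x(s)) ds` whose field is Lipschitz in `x` with an integrable constant `α(s)`.
In the sup norm with weight `exp (-2 ∫_a^t α)` the right-hand side is a contraction
(`exists_eq_add_integral`, `eqOn_of_eq_add_integral`). The solution, at first only continuous,
has the required smoothness: each pass through the equation gains one derivative until the
smoothness of the coefficients is used up, and each step from `y^{(s+1)}` to `y^{(s)}` gains one
more (`exists_isSolution`).

Well-posedness gives the unique Cauchy family `Y`, whose columns form a basis of `ker L` dual to the
initial values. Hence `B y = M v` when `L y = 0` and `v` is the vector of initial values of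
`y`, and since `L` is onto, `(L, B)` is bijective exactly when `M` is a bijection
(`bijective_prod_iff_bijective_mulVec`); for this `M` has to be square and nonsingular.

Finally, a bijective `(L, B)` is invertible in the sense of normed spaces by the open mapping
theorem. This needs the completeness of `W_p^k`, which follows from `y(t) = y(a) + ∫_a^t y'`
(`exists_memW_of_tendsto`), and the continuity of `L`, obtained from the closed graph theorem:
a norm-convergent sequence has a subsequence along which all derivatives involved converge almost
everywhere, so no estimates for the products `A_s y^{(s)}` are needed.
-/

namespace SobolevBVP

/-! ### Absolutely continuous functions and primitives -/

section Calculus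

variable {a b : ℝ} {p : ℝ≥0∞} {k : ℕ}

theorem ac_of_dist_le {X Y : Type*} [PseudoMetricSpace X] [PseudoMetricSpace Y]
    {F : ℝ → X} {G : ℝ → Y} (hG : AbsolutelyContinuousOnInterval G a b) (K : ℝ)
    (h : ∀ x ∈ uIcc a b, ∀ y ∈ uIcc a b, dist (F x) (F y) ≤ K * dist (G x) (G y)) :
    AbsolutelyContinuousOnInterval F a b := by
  rw [absolutelyContinuousOnInterval_iff] at hG ⊢
  intro ε hε
  obtain ⟨δ, hδ, H⟩ := hG (ε / (|K| + 1)) (by positivity)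
  refine ⟨δ, hδ, fun E hE hs => ?_⟩
  have h1 := H E hE hs
  rw [lt_div_iff₀ (by positivity)] at h1
  refine lt_of_le_of_lt ?_ h1
  rw [Finset.sum_mul]
  refine Finset.sum_le_sum fun i hi => ?_
  have h2 := h _ (hE.1 i hi).1 _ (hE.1 i hi).2
  have h3 := dist_nonneg (x := G (E.2 i).1) (y := G (E.2 i).2)
  nlinarith [le_abs_self K]

theorem ac_integral {E : Type*} [NormedAddCommGroup E] [NormedSpace ℝ E] {g : ℝ → E}
    (hg : IntervalIntegrable g volume a b) :
    AbsolutelyContinuousOnInterval (fun t => ∫ s in a..t, g s) a b := by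
  refine ac_of_dist_le (G := fun t => ∫ s in a..t, ‖g s‖)
    (hg.norm.absolutelyContinuousOnInterval_intervalIntegral left_mem_uIcc) 1 fun x hx y hy => ?_
  have hi (z) (hz : z ∈ uIcc a b) : IntervalIntegrable g volume a z :=
    hg.mono_set (uIcc_subset_uIcc left_mem_uIcc hz)
  rw [one_mul, dist_eq_norm, dist_eq_norm,
    intervalIntegral.integral_interval_sub_left (hi x hx) (hi y hy),
    intervalIntegral.integral_interval_sub_left (hi x hx).norm (hi y hy).norm]
  exact intervalIntegral.norm_integral_le_abs_integral_norm

theorem memLp_intervalIntegrable {E : Type*} [NormedAddCommGroup E] {g : ℝ → E}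
    (hab : a ≤ b) (hp : 1 ≤ p) (hg : MemLp g p (vol a b)) : IntervalIntegrable g volume a b :=
  (intervalIntegrable_iff_integrableOn_Icc_of_le hab).2 (hg.integrable hp)

/-- The fundamental theorem of calculus for complex absolutely continuous functions: the difference
of the two sides is absolutely continuous with derivative zero almost everywhere. -/
theorem ac_eq_integral (hab : a < b) {f : ℝ → ℂ} (hf : AbsolutelyContinuousOnInterval f a b)
    (hi : IntervalIntegrable (derivWithin f (Icc a b)) volume a b) {t : ℝ} (ht : t ∈ Icc a b) :
    f t = f a + ∫ s in a..t, derivWithin f (Icc a b) s := by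
  have hd : ∀ᵐ x, x ∈ uIcc a b →
      HasDerivAt (f - fun t => ∫ s in a..t, derivWithin f (Icc a b) s) 0 x := by
    have h1 := (ae_restrict_iff' measurableSet_Icc).1 (ac_ae_diff hab hf)
    have h2 : ∀ᵐ x : ℝ, x ≠ a := by simp [ae_iff, measure_singleton]
    have h3 : ∀ᵐ x : ℝ, x ≠ b := by simp [ae_iff, measure_singleton]
    filter_upwards [h1, h2, h3, hi.ae_hasDerivAt_integral] with x h1 h2 h3 h4 hx
    have hx' := hx
    rw [uIcc_of_le hab.le] at hx'
    have hn : Icc a b ∈ nhds x :=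
      Icc_mem_nhds (lt_of_le_of_ne hx'.1 h2.symm) (lt_of_le_of_ne hx'.2 h3)
    simpa using ((h1 hx').hasDerivWithinAt.hasDerivAt hn).sub (h4 hx a left_mem_uIcc)
  obtain ⟨C, hC⟩ := (hf.sub (ac_integral hi)).const_of_ae_hasDerivAt_zero hd
  rw [uIcc_of_le hab.le] at hC
  have h1 := hC t ht
  have h2 := hC a (left_mem_Icc.2 hab.le)
  simp only [Pi.sub_apply, intervalIntegral.integral_same, sub_zero] at h1 h2
  rw [h2, ← h1]
  ring

theorem memW_memLp (hab : a < b) {f : ℝ → ℂ} (hf : MemW a b p k f) : MemLp f p (vol a b) :=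
  memW_mono (j := 0) hab (Nat.zero_le k) hf

theorem memW_intervalIntegrable (hab : a < b) (hp : 1 ≤ p) {f : ℝ → ℂ} (hf : MemW a b p k f) :
    IntervalIntegrable f volume a b :=
  memLp_intervalIntegrable hab.le hp (memW_memLp hab hf)

theorem memW_eq_integral (hab : a < b) (hp : 1 ≤ p) {f : ℝ → ℂ} (hf : MemW a b p (k + 1) f)
    {t : ℝ} (ht : t ∈ Icc a b) : f t = f a + ∫ s in a..t, derivWithin f (Icc a b) s :=
  ac_eq_integral hab (memW_ac hab hf) (memW_intervalIntegrable hab hp (memW_deriv hab hf)) ht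

theorem ae_derivWithin_of_eq_integral (hab : a < b) {F g : ℝ → ℂ} {c : ℂ}
    (hg : IntervalIntegrable g volume a b)
    (hF : ∀ t ∈ Icc a b, F t = c + ∫ s in a..t, g s) :
    derivWithin F (Icc a b) =ᵐ[vol a b] g := by
  refine (ae_restrict_iff' measurableSet_Icc).2 ?_
  filter_upwards [hg.ae_hasDerivAt_integral] with x hx hxm
  have h := hx (by rwa [uIcc_of_le hab.le]) a left_mem_uIcc
  exact ((h.const_add c).hasDerivWithinAt.congr hF (hF x hxm)).derivWithin
    (uniqueDiffOn_Icc hab x hxm)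

theorem hasDerivWithinAt_of_eq_integral {F g : ℝ → ℂ} {c : ℂ}
    (hg : ContinuousOn g (Icc a b)) (hF : ∀ t ∈ Icc a b, F t = c + ∫ s in a..t, g s)
    {t : ℝ} (ht : t ∈ Icc a b) : HasDerivWithinAt F (g t) (Icc a b) t := by
  have : Fact (t ∈ Icc a b) := ⟨ht⟩
  refine HasDerivWithinAt.congr (HasDerivWithinAt.const_add c ?_) hF (hF t ht)
  refine intervalIntegral.integral_hasDerivWithinAt_right ?_
    (hg.stronglyMeasurableAtFilter_nhdsWithin measurableSet_Icc t) (hg t ht)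
  refine ContinuousOn.intervalIntegrable (hg.mono ?_)
  rw [uIcc_of_le ht.1]
  exact Icc_subset_Icc_right ht.2

/-- A primitive of a function of class `W_p^k` is of class `W_p^{k+1}`. -/
theorem memW_of_eq_integral (hab : a < b) (hp : 1 ≤ p) {F g : ℝ → ℂ} {c : ℂ}
    (hg : MemW a b p k g) (hF : ∀ t ∈ Icc a b, F t = c + ∫ s in a..t, g s) :
    MemW a b p (k + 1) F := by
  have hi := memW_intervalIntegrable hab hp hg
  cases k with
  | zero =>
    refine (memW_one hab).2 ⟨?_, (memLp_congr_ae (ae_derivWithin_of_eq_integral hab hi hF)).2 hg⟩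
    refine ac_of_dist_le (ac_integral hi) 1 fun x hx y hy => ?_
    rw [uIcc_of_le hab.le] at hx hy
    rw [hF x hx, hF y hy, dist_add_left, one_mul]
  | succ k =>
    have h (t) (ht : t ∈ Icc a b) := hasDerivWithinAt_of_eq_integral (memW_continuousOn hg) hF ht
    exact (memW_succ hab).2 ⟨fun t ht => (h t ht).differentiableWithinAt,
      memW_congr hab hg fun t ht => ((h t ht).derivWithin (uniqueDiffOn_Icc hab t ht)).symm⟩

end Calculus

/-! ### Integral equations with an integrable Lipschitz constant -/

section Caratheodory

variable {a b : ℝ}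

/-- This identity is why the weight `exp (-2 ∫_a^t α)` makes the integral operator a contraction. -/
theorem integral_mul_exp_integral (hab : a ≤ b) {α : ℝ → ℝ}
    (hα : IntervalIntegrable α volume a b) (K : ℝ) {t : ℝ} (ht : t ∈ Icc a b) :
    ∫ s in a..t, K * α s * Real.exp (K * ∫ u in a..s, α u) =
      Real.exp (K * ∫ u in a..t, α u) - 1 := by
  have ht' : t ∈ uIcc a b := by rwa [uIcc_of_le hab]
  have hα' : IntervalIntegrable α volume a t :=
    hα.mono_set (uIcc_subset_uIcc left_mem_uIcc ht')
  have hφ := (ac_integral hα').const_mul K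
  obtain ⟨C, hC⟩ := hφ.exists_bound
  have hexp : AbsolutelyContinuousOnInterval
      (fun s => Real.exp (K * ∫ u in a..s, α u)) a t := by
    obtain ⟨L, hL⟩ := (Real.contDiff_exp (n := 1)).contDiffOn.exists_lipschitzOnWith
      (s := Icc (-C) C) (by decide) (convex_Icc _ _) isCompact_Icc
    refine ac_of_dist_le hφ L fun x hx y hy => hL.dist_le_mul _ ?_ _ ?_
    · exact abs_le.1 (hC x hx)
    · exact abs_le.1 (hC y hy)
  have h := hexp.integral_deriv_eq_sub
  simp only [intervalIntegral.integral_same, mul_zero, Real.exp_zero] at h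
  rw [← h]
  refine intervalIntegral.integral_congr_ae ?_
  filter_upwards [hα'.ae_hasDerivAt_integral] with s hs hsm
  have := ((hs (uIoc_subset_uIcc hsm) a left_mem_uIcc).const_mul K).exp
  rw [this.deriv]
  ring

variable {E : Type*} [NormedAddCommGroup E] [NormedSpace ℝ E]

/-- A Carathéodory field on `[a, b]` that is globally Lipschitz in the state variable, with a
Lipschitz constant `α s` integrable in time. Instead of joint measurability, the integrability of
`s ↦ G s (x s)` along continuous `x` is required, which is all that the integral equation uses. -/
structure IsLipschitzField (a b : ℝ) (G : ℝ → E → E) (α : ℝ → ℝ) : Prop where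
  bound_nonneg : ∀ s, 0 ≤ α s
  integrable_bound : IntervalIntegrable α volume a b
  norm_sub_le : ∀ s u v, ‖G s u - G s v‖ ≤ α s * ‖u - v‖
  integrable_comp : ∀ x : ℝ → E, ContinuousOn x (Icc a b) →
    IntervalIntegrable (fun s => G s (x s)) volume a b

/-- The integral operator halves distances in the weighted sup norm: the bound `D` of the weighted
distance of `x` and `y` becomes `D / 2`. -/
theorem norm_integral_sub_le_of_weight {G : ℝ → E → E} {α : ℝ → ℝ} (hab : a ≤ b)
    (hG : IsLipschitzField a b G α) {x y : ℝ → E} (hx : ContinuousOn x (Icc a b))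
    (hy : ContinuousOn y (Icc a b)) {D : ℝ}
    (hD : ∀ s ∈ Icc a b, ‖x s - y s‖ ≤ D * Real.exp (2 * ∫ u in a..s, α u))
    {t : ℝ} (ht : t ∈ Icc a b) (hD0 : 0 ≤ D) :
    ‖(∫ s in a..t, G s (x s)) - ∫ s in a..t, G s (y s)‖ ≤
      D / 2 * Real.exp (2 * ∫ u in a..t, α u) := by
  have hsub : uIcc a t ⊆ uIcc a b := by
    rw [uIcc_of_le hab, uIcc_of_le ht.1]
    exact Icc_subset_Icc_right ht.2
  have hαt := hG.integrable_bound.mono_set hsub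
  rw [← intervalIntegral.integral_sub ((hG.integrable_comp x hx).mono_set hsub)
    ((hG.integrable_comp y hy).mono_set hsub)]
  have hc : ContinuousOn (fun s => Real.exp (2 * ∫ u in a..s, α u)) (uIcc a t) :=
    ((ac_integral hαt).continuousOn.const_mul 2).rexp
  calc _ ≤ ∫ s in a..t, D / 2 * (2 * α s * Real.exp (2 * ∫ u in a..s, α u)) := by
        refine intervalIntegral.norm_integral_le_of_norm_le ht.1
          (Filter.Eventually.of_forall fun s hs => ?_)
          (((hαt.const_mul 2).mul_continuousOn hc).const_mul _)
        refine (hG.norm_sub_le s _ _).trans ?_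
        have := mul_le_mul_of_nonneg_left (hD s ⟨hs.1.le, hs.2.trans ht.2⟩) (hG.bound_nonneg s)
        linarith
    _ = D / 2 * (Real.exp (2 * ∫ u in a..t, α u) - 1) := by
        rw [intervalIntegral.integral_const_mul,
          integral_mul_exp_integral hab hG.integrable_bound 2 ht]
    _ ≤ _ := by
        have : 0 ≤ D / 2 := by linarith
        linarith

/-- Uniqueness for the integral equation `x(t) = c + ∫_a^t G(s, x(s)) ds`. -/
theorem eqOn_of_eq_add_integral {G : ℝ → E → E} {α : ℝ → ℝ} (hab : a ≤ b)
    (hG : IsLipschitzField a b G α) (c : E) {x y : ℝ → E} (hx : ContinuousOn x (Icc a b))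
    (hy : ContinuousOn y (Icc a b)) (hxe : ∀ t ∈ Icc a b, x t = c + ∫ s in a..t, G s (x s))
    (hye : ∀ t ∈ Icc a b, y t = c + ∫ s in a..t, G s (y s)) : EqOn x y (Icc a b) := by
  have hα := hG.bound_nonneg
  obtain ⟨C, hC⟩ := isCompact_Icc.exists_bound_of_continuousOn (hx.sub hy)
  have hC0 : 0 ≤ C := (norm_nonneg _).trans (hC a (left_mem_Icc.2 hab))
  -- Each use of the integral equation halves the weighted bound of `x - y`.
  have key (N : ℕ) : ∀ s ∈ Icc a b,
      ‖x s - y s‖ ≤ C / 2 ^ N * Real.exp (2 * ∫ u in a..s, α u) := by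
    induction N with
    | zero =>
      intro s hs
      refine (hC s hs).trans ?_
      have : 0 ≤ ∫ u in a..s, α u := intervalIntegral.integral_nonneg hs.1 fun u _ => hα u
      have := Real.one_le_exp (x := 2 * ∫ u in a..s, α u) (by positivity)
      nlinarith
    | succ N ih =>
      intro s hs
      rw [hxe s hs, hye s hs, add_sub_add_left_eq_sub, pow_succ, ← div_div]
      exact norm_integral_sub_le_of_weight hab hG hx hy ih hs (by positivity)
  intro t ht
  rw [← sub_eq_zero, ← norm_le_zero_iff]
  refine ge_of_tendsto' (x := Filter.atTop) ?_ fun N => key N t ht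
  have h0 := (tendsto_pow_atTop_nhds_zero_of_lt_one (r := (1 / 2 : ℝ)) (by norm_num)
    (by norm_num)).const_mul C |>.mul_const (Real.exp (2 * ∫ u in a..t, α u))
  simpa [div_eq_mul_inv] using h0

/-- Existence for the integral equation `x(t) = c + ∫_a^t G(s, x(s)) ds`, by the contraction
principle. -/
theorem exists_eq_add_integral [CompleteSpace E] {G : ℝ → E → E} {α : ℝ → ℝ} (hab : a ≤ b)
    (hG : IsLipschitzField a b G α) (c : E) :
    ∃ x : ℝ → E, ContinuousOn x (Icc a b) ∧
      ∀ t ∈ Icc a b, x t = c + ∫ s in a..t, G s (x s) := by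
  have hα := hG.bound_nonneg
  have hφ : ContinuousOn (fun t => 2 * ∫ u in a..t, α u) (Icc a b) := by
    have := (ac_integral hG.integrable_bound).continuousOn.const_mul 2
    rwa [uIcc_of_le hab] at this
  set w : ℝ → ℝ := fun t => Real.exp (2 * ∫ u in a..t, α u) with hw
  have hwc : ContinuousOn w (Icc a b) := hφ.rexp
  have hw0 (t : ℝ) : 0 < w t := Real.exp_pos _
  -- With `x = w • z`, the weighted sup norm of `x` becomes the plain sup norm of `z`.
  let X (z : C(Icc a b, E)) : ℝ → E := fun t => w t • z (projIcc a b hab t)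
  have hX (z : C(Icc a b, E)) : ContinuousOn (X z) (Icc a b) :=
    hwc.smul (z.continuous.comp continuous_projIcc).continuousOn
  have hcont (z : C(Icc a b, E)) :
      ContinuousOn (fun t => (w t)⁻¹ • (c + ∫ s in a..t, G s (X z s))) (Icc a b) := by
    refine (hwc.inv₀ fun t _ => (hw0 t).ne').smul (continuousOn_const.add ?_)
    have := (ac_integral (hG.integrable_comp _ (hX z))).continuousOn
    rwa [uIcc_of_le hab] at this
  let Φ (z : C(Icc a b, E)) : C(Icc a b, E) := ⟨_, (hcont z).domRestrict⟩
  have hΦ (z : C(Icc a b, E)) (t : Icc a b) :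
      Φ z t = (w t)⁻¹ • (c + ∫ s in a..(t : ℝ), G s (X z s)) := rfl
  have hlip : ContractingWith (1 / 2 : NNReal) Φ := by
    refine ⟨half_lt_self one_pos,
      LipschitzWith.of_dist_le_mul fun z z' => ?_⟩
    rw [ContinuousMap.dist_le (by positivity)]
    intro t
    rw [hΦ, hΦ, dist_eq_norm, ← smul_sub, add_sub_add_left_eq_sub, norm_smul, norm_inv,
      Real.norm_of_nonneg (hw0 _).le, inv_mul_le_iff₀ (hw0 _)]
    refine (norm_integral_sub_le_of_weight hab hG (hX z) (hX z') (D := dist z z')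
      (fun s _ => ?_) t.2 dist_nonneg).trans (le_of_eq ?_)
    · simp only [X]
      rw [← smul_sub, norm_smul, Real.norm_of_nonneg (hw0 _).le, mul_comm, ← dist_eq_norm]
      exact mul_le_mul_of_nonneg_right (ContinuousMap.dist_apply_le_dist _) (hw0 _).le
    · simp [hw]
      ring
  have hfix := hlip.fixedPoint_isFixedPt
  set z := ContractingWith.fixedPoint Φ hlip
  refine ⟨X z, hX z, fun t ht => ?_⟩
  have h := hΦ z ⟨t, ht⟩
  rw [hfix] at h
  simp only [X, projIcc_of_mem hab ht]
  rw [h, smul_inv_smul₀ (hw0 t).ne']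

end Caratheodory

/-! ### Completeness of the Sobolev spaces and continuity of the differential operator -/

section Completeness

open Filter Topology

/-- Finitely many sequences converging in measure converge almost everywhere along a common
subsequence. -/
theorem exists_common_subseq_tendsto_ae {κ α E : Type*} [Finite κ] [MeasurableSpace α]
    {μ : Measure α} [PseudoEMetricSpace E] {F : κ → ℕ → α → E} {G : κ → α → E}
    (h : ∀ k, TendstoInMeasure μ (F k) atTop (G k)) :
    ∃ ns : ℕ → ℕ, StrictMono ns ∧
      ∀ k, ∀ᵐ t ∂μ, Tendsto (fun i => F k (ns i) t) atTop (𝓝 (G k t)) := by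
  classical
  have := Fintype.ofFinite κ
  suffices H : ∀ S : Finset κ, ∃ ns : ℕ → ℕ, StrictMono ns ∧
      ∀ k ∈ S, ∀ᵐ t ∂μ, Tendsto (fun i => F k (ns i) t) atTop (𝓝 (G k t)) by
    simpa using H Finset.univ
  intro S
  induction S using Finset.induction_on with
  | empty => exact ⟨id, strictMono_id, by simp⟩
  | insert k S _ ih =>
    obtain ⟨ns, hns, hS⟩ := ih
    have hk : TendstoInMeasure μ (fun i => F k (ns i)) atTop (G k) :=
      fun ε hε => (h k ε hε).comp hns.tendsto_atTop
    obtain ⟨ms, hms, hk'⟩ := hk.exists_seq_tendsto_ae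
    refine ⟨ns ∘ ms, hns.comp hms, fun j hj => ?_⟩
    rcases Finset.mem_insert.1 hj with rfl | hj
    · exact hk'
    · filter_upwards [hS j hj] with t ht
      exact ht.comp hms.tendsto_atTop

variable {a b : ℝ} {p : ℝ≥0∞}

theorem tendsto_integral_of_tendsto_eLpNorm (hp : 1 ≤ p) {F : ℕ → ℝ → ℂ}
    {g : ℝ → ℂ} (hF : ∀ i, MemLp (F i) p (vol a b)) (hg : MemLp g p (vol a b))
    (h : Tendsto (fun i => eLpNorm (F i - g) p (vol a b)) atTop (𝓝 0)) {t : ℝ}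
    (ht : t ∈ Icc a b) :
    Tendsto (fun i => ∫ s in a..t, F i s) atTop (𝓝 (∫ s in a..t, g s)) := by
  have h1 : Tendsto (fun i => eLpNorm (F i - g) 1 (vol a b)) atTop (𝓝 0) := by
    have hc : Tendsto (fun i => eLpNorm (F i - g) p (vol a b) *
        (vol a b) univ ^ (1 / (1 : ℝ≥0∞).toReal - 1 / p.toReal)) atTop (𝓝 0) := by
      have := ENNReal.Tendsto.mul_const (b := (vol a b) univ ^
        (1 / (1 : ℝ≥0∞).toReal - 1 / p.toReal)) h (Or.inr ?_)
      · simpa using this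
      · refine ENNReal.rpow_ne_top_of_nonneg ?_ (measure_ne_top _ _)
        rw [sub_nonneg, ENNReal.toReal_one, one_div_one]
        rcases eq_or_ne p ∞ with rfl | hpt
        · simp
        · have : 1 ≤ p.toReal := by simpa using ENNReal.toReal_mono hpt hp
          exact div_le_one_of_le₀ this (by positivity)
    exact tendsto_of_tendsto_of_tendsto_of_le_of_le tendsto_const_nhds hc (fun _ => zero_le)
      fun i => eLpNorm_le_eLpNorm_mul_rpow_measure_univ hp
        ((hF i).aestronglyMeasurable.sub hg.aestronglyMeasurable)
  have h2 := tendsto_setIntegral_of_L1' g hg.aestronglyMeasurable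
    (Eventually.of_forall fun i => (hF i).integrable hp) h1 (Ioc a t)
  have hr : (vol a b).restrict (Ioc a t) = volume.restrict (Ioc a t) :=
    Measure.restrict_restrict_of_subset fun s hs => ⟨hs.1.le, hs.2.trans ht.2⟩
  simpa only [intervalIntegral.integral_of_le ht.1, hr] using h2

/-- If the derivatives of order `j ≤ k` of functions of class `W_p^k` converge in `L_p` to functions
`v j`, then these are the derivatives of a single function of class `W_p^k`. -/
theorem exists_memW_of_tendsto (hab : a < b) (hp : 1 ≤ p) (k : ℕ) {y : ℕ → ℝ → ℂ}
    {v : ℕ → ℝ → ℂ} (hy : ∀ i, MemW a b p k (y i)) (hv : ∀ j ≤ k, MemLp (v j) p (vol a b))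
    (h : ∀ j ≤ k, Tendsto (fun i =>
      eLpNorm (iteratedDerivWithin j (y i) (Icc a b) - v j) p (vol a b)) atTop (𝓝 0)) :
    ∃ g, MemW a b p k g ∧ ∀ j ≤ k, iteratedDerivWithin j g (Icc a b) =ᵐ[vol a b] v j := by
  induction k generalizing y v with
  | zero =>
    refine ⟨v 0, hv 0 le_rfl, fun j hj => ?_⟩
    obtain rfl : j = 0 := by omega
    simp
  | succ k ih =>
    obtain ⟨g, hg, hgv⟩ := ih (y := fun i => derivWithin (y i) (Icc a b)) (v := fun j => v (j + 1))
      (fun i => memW_deriv hab (hy i)) (fun j hj => hv (j + 1) (by omega)) fun j hj => by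
        simpa only [iteratedDerivWithin_succ'] using h (j + 1) (by omega)
    have hg0 : g =ᵐ[vol a b] v 1 := by simpa using hgv 0 (Nat.zero_le k)
    have hint (t) (ht : t ∈ Icc a b) :
        Tendsto (fun i => ∫ s in a..t, derivWithin (y i) (Icc a b) s) atTop
          (𝓝 (∫ s in a..t, g s)) := by
      refine tendsto_integral_of_tendsto_eLpNorm hp
        (fun i => memW_memLp hab (memW_deriv hab (hy i))) (memW_memLp hab hg) ?_ ht
      refine (h 1 (by omega)).congr fun i => eLpNorm_congr_ae ?_
      rw [iteratedDerivWithin_one]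
      exact EventuallyEq.rfl.sub hg0.symm
    have hm : TendstoInMeasure (vol a b) y atTop (v 0) :=
      tendstoInMeasure_of_tendsto_eLpNorm (zero_lt_one.trans_le hp).ne'
        (fun i => (memW_memLp hab (hy i)).aestronglyMeasurable)
        (hv 0 (Nat.zero_le _)).aestronglyMeasurable (by simpa using h 0 (Nat.zero_le _))
    obtain ⟨ns, hns, hae⟩ := hm.exists_seq_tendsto_ae
    -- Convergence at a single point `t` forces convergence of the constants of integration.
    have hlim (t) (ht : t ∈ Icc a b) (h0 : Tendsto (fun i => y (ns i) t) atTop (𝓝 (v 0 t))) :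
        Tendsto (fun i => y (ns i) a) atTop (𝓝 (v 0 t - ∫ s in a..t, g s)) := by
      refine (h0.sub ((hint t ht).comp hns.tendsto_atTop)).congr fun i => ?_
      simp only [Function.comp_apply]
      rw [memW_eq_integral hab hp (hy (ns i)) ht, add_sub_cancel_right]
    have hae' : ∀ᵐ t ∂(vol a b), t ∈ Icc a b ∧
        Tendsto (fun i => y (ns i) t) atTop (𝓝 (v 0 t)) :=
      (ae_restrict_mem measurableSet_Icc).and hae
    have : NeBot (ae (vol a b)) := by
      rw [ae_neBot, Ne, Measure.restrict_eq_zero, Real.volume_Icc, ENNReal.ofReal_eq_zero]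
      linarith
    obtain ⟨t₀, ht₀, h₀⟩ := hae'.exists
    set c := v 0 t₀ - ∫ s in a..t₀, g s
    have hF (t) (_ : t ∈ Icc a b) : (fun t => c + ∫ s in a..t, g s) t = c + ∫ s in a..t, g s := rfl
    have hW := memW_of_eq_integral hab hp hg hF
    refine ⟨_, hW, fun j hj => ?_⟩
    cases j with
    | zero =>
      filter_upwards [hae'] with t ht
      have := tendsto_nhds_unique (hlim t₀ ht₀ h₀) (hlim t ht.1 ht.2)
      rw [iteratedDerivWithin_zero]
      exact (congrArg (· + ∫ s in a..t, g s) this).trans (sub_add_cancel _ _)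
    | succ j =>
      rw [iteratedDerivWithin_succ']
      exact (ae_iter_of_ae hab (by omega) (memW_deriv hab hW) hg
        (ae_derivWithin_of_eq_integral hab (memW_intervalIntegrable hab hp hg) hF)).trans
        (hgv j (by omega))

variable [hab : Fact (a < b)] [hp : Fact (1 ≤ p)] {k m n r l : ℕ}

theorem tendstoInMeasure_iter_rep {u : ℕ → W a b p k} {v : W a b p k}
    (h : Tendsto u atTop (𝓝 v)) (j : Fin (k + 1)) :
    TendstoInMeasure (vol a b) (fun i => iteratedDerivWithin j (rep (u i)) (Icc a b)) atTop
      (iteratedDerivWithin j (rep v) (Icc a b)) := by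
  have hj : Continuous fun w : W a b p k => w.1 j :=
    (PiLp.continuous_apply 1 _ j).comp continuous_subtype_val
  exact (tendstoInMeasure_of_tendsto_Lp ((hj.tendsto v).comp h)).congr
    (fun i => rep_ae (u i) j) (rep_ae v j)

theorem isClosed_WSub :
    IsClosed (WSub a b p k : Set (PiLp 1 fun _ : Fin (k + 1) => Lp ℂ p (vol a b))) := by
  refine IsSeqClosed.isClosed fun u v hu huv => ?_
  choose y hy huy using hu
  obtain ⟨g, hg, hgv⟩ := exists_memW_of_tendsto hab.out hp.out k
    (v := fun j => if h : j < k + 1 then v ⟨j, h⟩ else 0) hy (fun j hj => by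
      rw [dif_pos (Nat.lt_succ_of_le hj)]
      exact Lp.memLp _) fun j hj => by
      have hj' := Nat.lt_succ_of_le hj
      have h1 : Tendsto (fun i => u i ⟨j, hj'⟩) atTop (𝓝 (v ⟨j, hj'⟩)) :=
        ((PiLp.continuous_apply 1 _ _).tendsto v).comp huv
      refine ((Lp.tendsto_Lp_iff_tendsto_eLpNorm' _ _).1 h1).congr fun i => eLpNorm_congr_ae ?_
      rw [dif_pos hj']
      exact (huy i ⟨j, hj'⟩).sub EventuallyEq.rfl
  refine ⟨g, hg, fun j => ?_⟩
  have := hgv j (Nat.lt_succ_iff.1 j.2)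
  rw [dif_pos j.2] at this
  exact this.symm

instance : CompleteSpace (W a b p k) :=
  isClosed_WSub.completeSpace_coe

theorem diffOp_eq_iff {A : Fin r → Matrix (Fin m) (Fin m) (W a b p n)} {y : WVec a b p (n + r) m}
    {f : WVec a b p n m} : diffOp A y = f ↔ ∀ i, diffFun A y i =ᵐ[vol a b] rep (f i) := by
  constructor
  · rintro rfl i
    exact (rep_toW _ _).symm
  · exact fun h => PiLp.ext fun i => W_ext ((rep_toW _ _).trans (h i))

/-- The operator `L` is bounded, by the closed graph theorem: almost everywhere convergence along a
subsequence identifies the limit of `L (u N)`. -/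
theorem continuous_diffOp (A : Fin r → Matrix (Fin m) (Fin m) (W a b p n)) :
    Continuous (diffOp A) := by
  refine LinearMap.continuous_of_seq_closed_graph _ fun u y f hu hf => Eq.symm ?_
  rw [diffOp_eq_iff]
  intro i
  have hu' (d) : Tendsto (fun N => u N d) atTop (𝓝 (y d)) :=
    ((PiLp.continuous_apply 1 _ d).tendsto y).comp hu
  have hf' : Tendsto (fun N => diffOp A (u N) i) atTop (𝓝 (f i)) :=
    ((PiLp.continuous_apply 1 _ i).tendsto f).comp hf
  -- All derivatives of `u N` and the `i`-th component of `L (u N)` converge in measure; the index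
  -- `none` stands for the latter.
  obtain ⟨ns, -, hns⟩ := exists_common_subseq_tendsto_ae (μ := vol a b)
    (κ := Option (Fin m × Fin (n + r + 1)))
    (F := fun q N => q.elim (rep (diffOp A (u N) i))
      fun q => iteratedDerivWithin q.2 (rep (u N q.1)) (Icc a b))
    (G := fun q => q.elim (rep (f i)) fun q => iteratedDerivWithin q.2 (rep (y q.1)) (Icc a b))
    (by
      rintro (_ | ⟨d, s⟩)
      · simpa using tendstoInMeasure_iter_rep hf' 0
      · exact tendstoInMeasure_iter_rep (hu' d) s)
  have hL : ∀ᵐ t ∂(vol a b), ∀ N, diffFun A (u N) i t = rep (diffOp A (u N) i) t :=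
    ae_all_iff.2 fun N => diffOp_eq_iff.1 rfl i
  filter_upwards [ae_all_iff.2 hns, hL] with t ht hLt
  have hs (d : Fin m) (s : ℕ) (hs : s ≤ r) :
      Tendsto (fun N => iteratedDerivWithin s (rep (u (ns N) d)) (Icc a b) t) atTop
        (𝓝 (iteratedDerivWithin s (rep (y d)) (Icc a b) t)) :=
    ht (some (d, ⟨s, by omega⟩))
  have h1 : Tendsto (fun N => diffFun A (u (ns N)) i t) atTop (𝓝 (diffFun A y i t)) :=
    (hs i r le_rfl).add (tendsto_finsetSum _ fun s _ => tendsto_finsetSum _ fun d _ =>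
      (hs d s s.2.le).const_mul _)
  refine tendsto_nhds_unique h1 ?_
  simp only [hLt]
  exact ht none

end Completeness

/-! ### The Cauchy problem for functions -/

section Cauchy

variable {a b : ℝ} {p : ℝ≥0∞} {n m r : ℕ}

/-- In contrast to `memW_mul`, the second factor need not have an extra derivative: its continuity
matters only for `k = 0`. -/
theorem memW_mul_of_continuousOn (hab : a < b) {k : ℕ} {f g : ℝ → ℂ} (hf : MemW a b p k f)
    (hg : MemW a b p k g) (hgc : ContinuousOn g (Icc a b)) : MemW a b p k (f * g) := by
  cases k with
  | zero => exact memLp_mul_continuousOn hf hgc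
  | succ k => exact memW_mul_self hab hf hg

/-- The field of the first-order system for `u = (y, y', …, y^{(r-1)})` that is equivalent to
`y^{(r)} + ∑_s A_s y^{(s)} = f`; the entry `u (s, i)` stands for the `i`-th component of
`y^{(s)}`. -/
def companionField (A : Fin r → Fin m → Fin m → ℝ → ℂ) (f : Fin m → ℝ → ℂ) (t : ℝ)
    (u : Fin r × Fin m → ℂ) : Fin r × Fin m → ℂ := fun q =>
  if h : q.1.1 + 1 < r then u (⟨q.1.1 + 1, h⟩, q.2)
  else f q.2 t - ∑ s, ∑ d, A s q.2 d t * u (s, d)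

variable {A : Fin r → Fin m → Fin m → ℝ → ℂ} {f : Fin m → ℝ → ℂ}

theorem companionField_integrable (hab : a < b)
    (hA : ∀ s i d, IntervalIntegrable (A s i d) volume a b)
    (hf : ∀ i, IntervalIntegrable (f i) volume a b) {x : ℝ → Fin r × Fin m → ℂ}
    (hx : ContinuousOn x (Icc a b)) (q : Fin r × Fin m) :
    IntervalIntegrable (fun s => companionField A f s (x s) q) volume a b := by
  have hx' (q) : ContinuousOn (fun t => x t q) (uIcc a b) := by
    rw [uIcc_of_le hab.le]
    exact continuousOn_pi.1 hx q
  by_cases h : q.1.1 + 1 < r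
  · simpa only [companionField, dif_pos h] using (hx' _).intervalIntegrable
  · simp only [companionField, dif_neg h]
    refine (hf q.2).sub ?_
    have h1 := IntervalIntegrable.sum (μ := volume) (a := a) (b := b) Finset.univ
      (f := fun sd : Fin r × Fin m => fun t => A sd.1 q.2 sd.2 t * x t sd)
      fun sd _ => (hA sd.1 q.2 sd.2).mul_continuousOn (hx' sd)
    refine h1.congr fun t _ => ?_
    simp [Fintype.sum_prod_type]

theorem isLipschitzField_companionField (hab : a < b)
    (hA : ∀ s i d, IntervalIntegrable (A s i d) volume a b)
    (hf : ∀ i, IntervalIntegrable (f i) volume a b) :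
    IsLipschitzField a b (companionField A f) fun t => 1 + ∑ q : Fin m × Fin r × Fin m,
      ‖A q.2.1 q.1 q.2.2 t‖ where
  bound_nonneg t := by positivity
  integrable_bound := by
    refine IntervalIntegrable.add intervalIntegrable_const ?_
    have h1 := IntervalIntegrable.sum (μ := volume) (a := a) (b := b) Finset.univ
      (f := fun q : Fin m × Fin r × Fin m => fun t => ‖A q.2.1 q.1 q.2.2 t‖)
      fun q _ => (hA _ _ _).norm
    refine h1.congr fun t _ => ?_
    simp
  norm_sub_le t u v := by
    have h0 : 0 ≤ ∑ q : Fin m × Fin r × Fin m, ‖A q.2.1 q.1 q.2.2 t‖ := by positivity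
    rw [pi_norm_le_iff_of_nonneg (by positivity)]
    intro q
    by_cases h : q.1.1 + 1 < r
    · simp only [Pi.sub_apply, companionField, dif_pos h]
      refine (norm_le_pi_norm (u - v) (⟨q.1.1 + 1, h⟩, q.2)).trans ?_
      nlinarith [norm_nonneg (u - v)]
    · simp only [Pi.sub_apply, companionField, dif_neg h]
      rw [sub_sub_sub_cancel_left, ← Fintype.sum_prod_type', ← Fintype.sum_prod_type',
        ← Finset.sum_sub_distrib]
      simp only [← mul_sub]
      calc _ ≤ ∑ sd : Fin r × Fin m, ‖A sd.1 q.2 sd.2 t‖ * ‖u - v‖ := by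
            refine norm_sum_le_of_le _ fun sd _ => ?_
            rw [norm_mul, norm_sub_rev]
            exact mul_le_mul_of_nonneg_left (norm_le_pi_norm (u - v) sd) (norm_nonneg _)
        _ = (∑ sd : Fin r × Fin m, ‖A sd.1 q.2 sd.2 t‖) * ‖u - v‖ := by rw [Finset.sum_mul]
        _ ≤ _ := by
            refine mul_le_mul_of_nonneg_right ?_ (norm_nonneg _)
            have : ∑ sd : Fin r × Fin m, ‖A sd.1 q.2 sd.2 t‖ ≤
                ∑ i : Fin m, ∑ sd : Fin r × Fin m, ‖A sd.1 i sd.2 t‖ :=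
              Finset.single_le_sum (f := fun i => ∑ sd : Fin r × Fin m, ‖A sd.1 i sd.2 t‖)
                (fun i _ => by positivity) (Finset.mem_univ q.2)
            rw [← Fintype.sum_prod_type'] at this
            linarith
  integrable_comp x hx := by
    have h := companionField_integrable hab hA hf hx
    simp only [intervalIntegrable_iff_integrableOn_Ioc_of_le hab.le] at h ⊢
    exact Integrable.of_eval h

theorem integral_companionField_apply (hab : a < b)
    (hA : ∀ s i d, IntervalIntegrable (A s i d) volume a b)
    (hf : ∀ i, IntervalIntegrable (f i) volume a b) {x : ℝ → Fin r × Fin m → ℂ}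
    (hx : ContinuousOn x (Icc a b)) {t : ℝ} (ht : t ∈ Icc a b) (q : Fin r × Fin m) :
    (∫ s in a..t, companionField A f s (x s)) q = ∫ s in a..t, companionField A f s (x s) q := by
  have hi := (isLipschitzField_companionField hab hA hf).integrable_comp x hx
  have ht' : uIcc a t ⊆ uIcc a b := by
    rw [uIcc_of_le hab.le, uIcc_of_le ht.1]
    exact Icc_subset_Icc_right ht.2
  exact ((ContinuousLinearMap.proj (R := ℝ) (φ := fun _ : Fin r × Fin m => ℂ)
    q).intervalIntegral_comp_comm (hi.mono_set ht')).symm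

/-- `y^{(r)} + ∑_s A_s y^{(s)} = f` almost everywhere on `[a, b]`, for vector functions given by
their components. -/
def IsSolution (a b : ℝ) (A : Fin r → Fin m → Fin m → ℝ → ℂ) (f y : Fin m → ℝ → ℂ) : Prop :=
  ∀ i, ∀ᵐ t ∂(vol a b), iteratedDerivWithin r (y i) (Icc a b) t +
    ∑ s : Fin r, ∑ d, A s i d t * iteratedDerivWithin s (y d) (Icc a b) t = f i t

theorem memW_iter_of_lt (hab : a < b) {y : ℝ → ℂ} (hy : MemW a b p (n + r) y) {s : ℕ}
    (hs : s < r) : MemW a b p (n + (r - 1 - s) + 1) (iteratedDerivWithin s y (Icc a b)) := by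
  refine memW_iter hab s ?_
  convert hy using 1
  omega

theorem continuousOn_iter (hab : a < b) {y : ℝ → ℂ} (hy : MemW a b p (n + r) y) {s : ℕ}
    (hs : s < r) : ContinuousOn (iteratedDerivWithin s y (Icc a b)) (Icc a b) :=
  memW_continuousOn (memW_iter_of_lt hab hy hs)

/-- The derivatives of order less than `r` of a solution solve the integral equation of the companion
field. -/
theorem IsSolution.eq_add_integral (hab : a < b) (hp : 1 ≤ p)
    (hA : ∀ s i d, MemW a b p n (A s i d)) (hf : ∀ i, MemW a b p n (f i)) {y : Fin m → ℝ → ℂ}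
    (hy : ∀ i, MemW a b p (n + r) (y i)) (h : IsSolution a b A f y) {t : ℝ} (ht : t ∈ Icc a b) :
    (fun q : Fin r × Fin m => iteratedDerivWithin q.1 (y q.2) (Icc a b) t) =
      (fun q : Fin r × Fin m => iteratedDerivWithin q.1 (y q.2) (Icc a b) a) +
        ∫ s in a..t, companionField A f s fun q => iteratedDerivWithin q.1 (y q.2) (Icc a b) s := by
  ext q
  rw [Pi.add_apply, integral_companionField_apply hab
    (fun s i d => memW_intervalIntegrable hab hp (hA s i d))
    (fun i => memW_intervalIntegrable hab hp (hf i))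
    (continuousOn_pi.2 fun q => continuousOn_iter hab (hy q.2) q.1.2) ht,
    memW_eq_integral hab hp (memW_iter_of_lt hab (hy q.2) q.1.2) ht]
  congr 1
  refine intervalIntegral.integral_congr_ae ?_
  filter_upwards [(ae_restrict_iff' measurableSet_Icc).1 (h q.2)] with s hs hsm
  rw [uIoc_of_le ht.1] at hsm
  rw [← iteratedDerivWithin_succ]
  by_cases hq : q.1.1 + 1 < r
  · simp only [companionField, dif_pos hq]
  · have hq' : q.1.1 + 1 = r := by omega
    simp only [companionField, dif_neg hq]
    rw [← hs ⟨hsm.1.le, hsm.2.trans ht.2⟩, hq', add_sub_cancel_right]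

/-- Uniqueness for the Cauchy problem. -/
theorem IsSolution.eqOn (hab : a < b) (hp : 1 ≤ p) (hr : 1 ≤ r)
    (hA : ∀ s i d, MemW a b p n (A s i d)) (hf : ∀ i, MemW a b p n (f i)) {y z : Fin m → ℝ → ℂ}
    (hy : ∀ i, MemW a b p (n + r) (y i)) (hz : ∀ i, MemW a b p (n + r) (z i))
    (hys : IsSolution a b A f y) (hzs : IsSolution a b A f z)
    (h : ∀ (s : Fin r) i, iteratedDerivWithin s (y i) (Icc a b) a =
      iteratedDerivWithin s (z i) (Icc a b) a) (i : Fin m) : EqOn (y i) (z i) (Icc a b) := by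
  intro t ht
  have key := eqOn_of_eq_add_integral hab.le (isLipschitzField_companionField hab
    (fun s i d => memW_intervalIntegrable hab hp (hA s i d))
    (fun i => memW_intervalIntegrable hab hp (hf i)))
    (fun q : Fin r × Fin m => iteratedDerivWithin q.1 (y q.2) (Icc a b) a)
    (continuousOn_pi.2 fun q => continuousOn_iter hab (hy q.2) q.1.2)
    (continuousOn_pi.2 fun q => continuousOn_iter hab (hz q.2) q.1.2)
    (fun t ht => hys.eq_add_integral hab hp hA hf hy ht) (fun t ht => by
      simp only [h]
      exact hzs.eq_add_integral hab hp hA hf hz ht) ht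
  simpa using congrFun key (⟨0, hr⟩, i)

/-- Existence for the Cauchy problem, with a solution of the full smoothness `W_p^{n+r}`. -/
theorem exists_isSolution (hab : a < b) (hp : 1 ≤ p) (hr : 1 ≤ r)
    (hA : ∀ s i d, MemW a b p n (A s i d)) (hf : ∀ i, MemW a b p n (f i))
    (c : Fin r → Fin m → ℂ) :
    ∃ y : Fin m → ℝ → ℂ, (∀ i, MemW a b p (n + r) (y i)) ∧ IsSolution a b A f y ∧
      ∀ (s : Fin r) i, iteratedDerivWithin s (y i) (Icc a b) a = c s i := by
  have hAi (s i d) := memW_intervalIntegrable hab hp (hA s i d)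
  have hfi (i) := memW_intervalIntegrable hab hp (hf i)
  obtain ⟨x, hx, hxe⟩ := exists_eq_add_integral hab.le
    (isLipschitzField_companionField hab hAi hfi) fun q : Fin r × Fin m => c q.1 q.2
  have hxc (q) : ContinuousOn (fun t => x t q) (Icc a b) := continuousOn_pi.1 hx q
  have hxq (q) (t) (ht : t ∈ Icc a b) :
      x t q = c q.1 q.2 + ∫ s in a..t, companionField A f s (x s) q := by
    rw [← integral_companionField_apply hab hAi hfi hx ht, ← Pi.add_apply
      (f := fun q : Fin r × Fin m => c q.1 q.2), ← hxe t ht]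
  -- Each use of the equation gains a derivative, up to one more than the coefficients have.
  have hreg (k : ℕ) : k ≤ n + 1 → ∀ q, MemW a b p k fun t => x t q := by
    induction k with
    | zero => exact fun _ q => memLp_of_continuousOn (hxc q) p
    | succ k ih =>
      intro hk q
      refine memW_of_eq_integral hab hp ?_ (hxq q)
      have ih := ih (by omega)
      by_cases hq : q.1.1 + 1 < r
      · simpa only [companionField, dif_pos hq] using ih _
      · have h1 := memW_add hab (memW_mono hab (show k ≤ n by omega) (hf q.2))
          (memW_smul (-1) (memW_sum hab Finset.univ
          (fun s : Fin r => ∑ d : Fin m, A s q.2 d * fun t => x t (s, d)) fun s _ =>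
          memW_sum hab _ _ fun d _ => memW_mul_of_continuousOn hab
            (memW_mono hab (show k ≤ n by omega) (hA s q.2 d)) (ih _) (hxc _)))
        refine memW_congr hab h1 fun t _ => ?_
        simp [companionField, dif_neg hq, sub_eq_add_neg]
  have hstep (k : ℕ) (hk : k + 1 < r) (i : Fin m) (t) (ht : t ∈ Icc a b) :
      x t (⟨k, by omega⟩, i) = c ⟨k, by omega⟩ i + ∫ s in a..t, x s (⟨k + 1, hk⟩, i) := by
    rw [hxq _ t ht]
    simp only [companionField, dif_pos hk]
  -- Each step from `y^{(k+1)}` to its primitive `y^{(k)}` gains one more derivative.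
  have hreg' (j : ℕ) : ∀ (k : ℕ) (hk : k + 1 + j = r) (i : Fin m),
      MemW a b p (n + 1 + j) fun t => x t (⟨k, by omega⟩, i) := by
    induction j with
    | zero => exact fun k hk i => hreg (n + 1) le_rfl _
    | succ j ih => exact fun k hk i =>
        memW_of_eq_integral hab hp (ih (k + 1) (by omega) i) (hstep k (by omega) i)
  have hder (i : Fin m) (k : ℕ) : ∀ (hk : k < r),
      EqOn (iteratedDerivWithin k (fun t => x t (⟨0, hr⟩, i)) (Icc a b))
        (fun t => x t (⟨k, hk⟩, i)) (Icc a b) := by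
    induction k with
    | zero => exact fun _ t _ => by simp
    | succ k ih =>
      intro hk t ht
      rw [iteratedDerivWithin_succ, derivWithin_congr (ih (by omega)) (ih (by omega) ht)]
      exact (hasDerivWithinAt_of_eq_integral (hxc _) (hstep k hk i) ht).derivWithin
        (uniqueDiffOn_Icc hab t ht)
  refine ⟨fun i t => x t (⟨0, hr⟩, i), fun i => ?_, fun i => ?_, fun s i => ?_⟩
  · convert hreg' (r - 1) 0 (by omega) i using 1
    omega
  · obtain ⟨k, rfl⟩ : ∃ k, r = k + 1 := ⟨r - 1, by omega⟩
    have hi : IntervalIntegrable (fun t => companionField A f t (x t) (Fin.last k, i))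
        volume a b := companionField_integrable hab hAi hfi hx _
    have h1 := ae_derivWithin_of_eq_integral hab hi (hxq (Fin.last k, i))
    filter_upwards [h1, ae_restrict_mem measurableSet_Icc] with t h1 ht
    have h2 : iteratedDerivWithin (k + 1) (fun t => x t (⟨0, hr⟩, i)) (Icc a b) t =
        companionField A f t (x t) (Fin.last k, i) := by
      rw [iteratedDerivWithin_succ, ← h1]
      exact derivWithin_congr (hder i k (by omega)) (hder i k (by omega) ht)
    rw [h2]
    have h3 (s : Fin (k + 1)) (d : Fin m) := hder d s s.2 ht
    simp only [h3]
    simp [companionField]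
  · rw [hder i s s.2 (left_mem_Icc.2 hab.le)]
    simp [hxq _ a (left_mem_Icc.2 hab.le)]

end Cauchy

/-! ### Reduction to the characteristic matrix -/

section LinearAlgebra

/-- Let `y ↦ (L y, T y)` be a bijection and let `Y q ∈ ker L` be the basis of `ker L` dual to the
coordinates of `T`. Then `y ↦ (L y, B y)` is bijective if and only if the matrix with columns
`B (Y q)` acts bijectively. -/
theorem bijective_prod_iff_bijective_mulVec {K V F κ ι : Type*} [Field K] [AddCommGroup V]
    [Module K V] [AddCommGroup F] [Module K F] [Fintype κ] [DecidableEq κ] {L : V →ₗ[K] F}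
    {T : V →ₗ[K] κ → K} (h : Function.Bijective (L.prod T)) (B : V →ₗ[K] ι → K) {Y : κ → V}
    (hL : ∀ q, L (Y q) = 0) (hT : ∀ q, T (Y q) = Pi.single q 1) :
    Function.Bijective (L.prod B) ↔
      Function.Bijective (Matrix.of fun i q => B (Y q) i).mulVec := by
  set M : Matrix ι κ K := Matrix.of fun i q => B (Y q) i
  let S (c : κ → K) : V := ∑ q, c q • Y q
  have hLS (c) : L (S c) = 0 := by simp [S, hL]
  have hTS (c) : T (S c) = c := by
    simp only [S, map_sum, map_smul, hT]
    ext q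
    simp [Pi.single_apply]
  have hBS (c) : B (S c) = M.mulVec c := by
    ext i
    simp [S, M, Matrix.mulVec, dotProduct, mul_comm]
  have hS (y) (hy : L y = 0) : S (T y) = y := h.1 (by simp [hLS, hTS, hy])
  have hB (y) (hy : L y = 0) : M.mulVec (T y) = B y := by rw [← hBS, hS y hy]
  constructor
  · refine fun hb => ⟨fun c d hcd => ?_, fun q => ?_⟩
    · have : S c = S d := hb.1 (by simp [hLS, hBS, hcd])
      rw [← hTS c, this, hTS]
    · obtain ⟨y, hy⟩ := hb.2 (0, q)
      rw [LinearMap.prod_apply, Function.prod_apply, Prod.mk.injEq] at hy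
      exact ⟨T y, by rw [hB y hy.1, hy.2]⟩
  · refine fun hb => ⟨(injective_iff_map_eq_zero _).2 fun y hy => ?_, fun ⟨f, q⟩ => ?_⟩
    · rw [LinearMap.prod_apply, Function.prod_apply, Prod.mk_eq_zero] at hy
      have : T y = 0 := hb.1 (by rw [hB y hy.1, hy.2, Matrix.mulVec_zero])
      exact h.1 (by simp [hy.1, this])
    · obtain ⟨y, hy⟩ := h.2 (f, 0)
      rw [LinearMap.prod_apply, Function.prod_apply, Prod.mk.injEq] at hy
      obtain ⟨c, hc⟩ := hb.2 (q - B y)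
      exact ⟨y + S c, by simp [hLS, hBS, hy.1, hc]⟩

theorem bijective_mulVec_iff_exists_isUnit {K : Type*} [Field K] {l k : ℕ}
    (M : Matrix (Fin l) (Fin k) K) :
    Function.Bijective M.mulVec ↔ ∃ h : l = k, IsUnit (M.submatrix (Fin.cast h.symm) id) := by
  constructor
  · intro hb
    obtain rfl : l = k := by
      have := (LinearEquiv.ofBijective M.mulVecLin hb).finrank_eq
      simpa using this.symm
    exact ⟨rfl, Matrix.mulVec_injective_iff_isUnit.1 hb.1⟩
  · rintro ⟨rfl, h⟩
    exact ⟨Matrix.mulVec_injective_iff_isUnit.2 h, Matrix.mulVec_surjective_iff_isUnit.2 h⟩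

end LinearAlgebra

/-! ### The Cauchy problem and the boundary-value problem in Sobolev spaces -/

section BoundaryValueProblem

variable {a b : ℝ} [hab : Fact (a < b)] {p : ℝ≥0∞} [hp : Fact (1 ≤ p)] {n m r l : ℕ}

/-- The initial values `y_i^{(s)}(a)`, `s < r`, `i < m`, as a vector of length `r * m`; the value for
`(s, i)` has the index `finProdFinEquiv (s, i)`, as in `charMatrix`. They depend linearly on `y`
because the derivatives of order less than `r ≤ n + r` have continuous representatives. -/
noncomputable def initialTrace (a b : ℝ) [hab : Fact (a < b)] (p : ℝ≥0∞) [Fact (1 ≤ p)]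
    (n m r : ℕ) : WVec a b p (n + r) m →ₗ[ℂ] Fin (r * m) → ℂ where
  toFun y x := iteratedDerivWithin (finProdFinEquiv.symm x).1
    (rep (y (finProdFinEquiv.symm x).2)) (Icc a b) a
  map_add' y z := by
    ext x
    have hs := (finProdFinEquiv.symm x).1.2
    have hc (u : W a b p (n + r)) := continuousOn_iter hab.out (rep_mem u) hs
    exact Measure.eqOn_Icc_of_ae_eq volume hab.out.ne (rep_add _ _ (hs.le.trans (by omega)))
      (hc _) ((hc _).add (hc _)) (left_mem_Icc.2 hab.out.le)
  map_smul' c y := by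
    ext x
    have hs := (finProdFinEquiv.symm x).1.2
    have hc (u : W a b p (n + r)) := continuousOn_iter hab.out (rep_mem u) hs
    exact Measure.eqOn_Icc_of_ae_eq volume hab.out.ne (rep_smul _ _ (hs.le.trans (by omega)))
      (hc _) ((hc _).const_smul c) (left_mem_Icc.2 hab.out.le)

theorem initialTrace_finProdFinEquiv (y : WVec a b p (n + r) m) (s : Fin r) (i : Fin m) :
    initialTrace a b p n m r y (finProdFinEquiv (s, i)) =
      iteratedDerivWithin s (rep (y i)) (Icc a b) a := by
  simp only [initialTrace, LinearMap.coe_mk, AddHom.coe_mk, Equiv.symm_apply_apply]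

theorem diffOp_eq_iff_isSolution {A : Fin r → Matrix (Fin m) (Fin m) (W a b p n)}
    {y : WVec a b p (n + r) m} {f : WVec a b p n m} :
    diffOp A y = f ↔ IsSolution a b (fun s i d => rep (A s i d)) (fun i => rep (f i))
      fun i => rep (y i) :=
  diffOp_eq_iff

/-- The Cauchy problem `L y = f`, `y_i^{(s)}(a) = c_{s,i}`, is uniquely solvable in
`(W_p^{n+r})^m` for all `f ∈ (W_p^n)^m` and all `c`. -/
theorem bijective_diffOp_prod_initialTrace (hr : 1 ≤ r)
    (A : Fin r → Matrix (Fin m) (Fin m) (W a b p n)) :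
    Function.Bijective ((diffOp A).prod (initialTrace a b p n m r)) := by
  constructor
  · intro y z h
    rw [LinearMap.prod_apply, LinearMap.prod_apply, Function.prod_apply,
      Function.prod_apply, Prod.mk.injEq] at h
    refine PiLp.ext fun i => W_ext (ae_of_eqOn ?_)
    refine (diffOp_eq_iff_isSolution.1 h.1).eqOn hab.out hp.out hr (fun s i d => rep_mem _)
      (fun i => rep_mem _) (fun i => rep_mem _) (fun i => rep_mem _)
      (diffOp_eq_iff_isSolution.1 rfl) (fun s d => ?_) i
    simpa only [initialTrace_finProdFinEquiv] using congrFun h.2 (finProdFinEquiv (s, d))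
  · rintro ⟨f, c⟩
    obtain ⟨y, hy, hys, hyc⟩ := exists_isSolution hab.out hp.out hr
      (fun s i d => rep_mem (A s i d)) (fun i => rep_mem (f i))
      fun s i => c (finProdFinEquiv (s, i))
    have hrep (i) : EqOn (rep (toW (y i) (hy i))) (y i) (Icc a b) :=
      Measure.eqOn_Icc_of_ae_eq volume hab.out.ne (rep_toW _ _)
        (continuousOn_iter hab.out (rep_mem (toW (y i) (hy i))) hr)
        (continuousOn_iter hab.out (hy i) hr)
    have hiter (i s) : EqOn (iteratedDerivWithin s (rep (toW (y i) (hy i))) (Icc a b))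
        (iteratedDerivWithin s (y i) (Icc a b)) (Icc a b) := iteratedDerivWithin_congr (hrep i)
    refine ⟨WithLp.toLp 1 fun i => toW (y i) (hy i), ?_⟩
    rw [LinearMap.prod_apply, Function.prod_apply, Prod.mk.injEq]
    constructor
    · rw [diffOp_eq_iff_isSolution]
      intro i
      filter_upwards [hys i, ae_restrict_mem measurableSet_Icc] with t ht htm
      simpa only [hiter _ _ htm] using ht
    · ext x
      obtain ⟨⟨s, i⟩, rfl⟩ := finProdFinEquiv.surjective x
      rw [initialTrace_finProdFinEquiv, ← hyc s i]
      exact hiter i s (left_mem_Icc.2 hab.out.le)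

/-- The Cauchy families are those whose columns lie in `ker L` and are dual to the initial values. -/
theorem isCauchyFamily_iff {A : Fin r → Matrix (Fin m) (Fin m) (W a b p n)}
    {Y : Fin r → Matrix (Fin m) (Fin m) (W a b p (n + r))} :
    IsCauchyFamily A Y ↔ ∀ i d, (diffOp A).prod (initialTrace a b p n m r) (column (Y i) d) =
      (0, Pi.single (finProdFinEquiv (i, d)) 1) := by
  have h (i d) : initialTrace a b p n m r (column (Y i) d) =
      Pi.single (finProdFinEquiv (i, d)) 1 ↔ ∀ (j : Fin r) (c : Fin m),
        iteratedDerivWithin j (rep (Y i c d)) (Icc a b) a =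
          (if i = j then 1 else 0 : Matrix (Fin m) (Fin m) ℂ) c d := by
    rw [funext_iff, ← finProdFinEquiv.forall_congr_right, Prod.forall]
    refine forall₂_congr fun j c => ?_
    rw [initialTrace_finProdFinEquiv]
    by_cases hij : i = j <;>
    simp [column, Pi.single_apply, Matrix.one_apply, hij, eq_comm]
  have hprod (i d) : (diffOp A).prod (initialTrace a b p n m r) (column (Y i) d) =
      (0, Pi.single (finProdFinEquiv (i, d)) 1) ↔ diffOp A (column (Y i) d) = 0 ∧
        initialTrace a b p n m r (column (Y i) d) = Pi.single (finProdFinEquiv (i, d)) 1 :=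
    Prod.ext_iff
  simp only [hprod, h, forall_and (α := Fin m), IsCauchyFamily, ← Matrix.ext_iff,
    Matrix.of_apply]
  exact forall_congr' fun i => and_congr_right fun _ =>
    ⟨fun H d j c => H j c d, fun H j c d => H d j c⟩

theorem existsUnique_isCauchyFamily (hr : 1 ≤ r)
    (A : Fin r → Matrix (Fin m) (Fin m) (W a b p n)) : ∃! Y, IsCauchyFamily A Y := by
  have hb := bijective_diffOp_prod_initialTrace hr A
  simp only [isCauchyFamily_iff]
  choose y hy using fun i d => hb.2 (0, Pi.single (finProdFinEquiv (i, d)) 1)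
  refine ⟨fun i => Matrix.of fun c d => y i d c, hy, fun Y hY => ?_⟩
  ext i c d
  exact congrArg (fun u : WVec a b p (n + r) m => u c) (hb.1 ((hY i d).trans (hy i d).symm))

/-- Boundedness of `(L, B)` and of its inverse is automatic. -/
theorem isInvertibleOp_bvpOp_iff_bijective (A : Fin r → Matrix (Fin m) (Fin m) (W a b p n))
    (B : WVec a b p (n + r) m →L[ℂ] (Fin l → ℂ)) :
    IsInvertibleOp (bvpOp A B) ↔ Function.Bijective (bvpOp A B) := by
  constructor
  · rintro ⟨e, he⟩
    rw [← funext he]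
    exact e.bijective
  · intro hb
    let T : WVec a b p (n + r) m →L[ℂ] WVec a b p n m × (Fin l → ℂ) :=
      ⟨bvpOp A B, (continuous_diffOp A).prodMk B.continuous⟩
    exact ⟨ContinuousLinearEquiv.ofBijective T (LinearMap.ker_eq_bot.2 hb.1)
      (LinearMap.range_eq_top.2 hb.2), fun _ => rfl⟩

end BoundaryValueProblem

end SobolevBVP

theorem corollary1 (a b : ℝ) [Fact (a < b)] (p : ℝ≥0∞) [Fact (1 ≤ p)]
    (n m r l : ℕ) (hm : 1 ≤ m) (hr : 1 ≤ r) (hl : 1 ≤ l)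
    (A : Fin r → Matrix (Fin m) (Fin m) (SobolevBVP.W a b p n))
    (B : SobolevBVP.WVec a b p (n + r) m →L[ℂ] (Fin l → ℂ)) :
    (∃! Y : Fin r → Matrix (Fin m) (Fin m) (SobolevBVP.W a b p (n + r)),
      SobolevBVP.IsCauchyFamily A Y) ∧
    ∀ Y : Fin r → Matrix (Fin m) (Fin m) (SobolevBVP.W a b p (n + r)),
      SobolevBVP.IsCauchyFamily A Y →
      (SobolevBVP.IsInvertibleOp (SobolevBVP.bvpOp A B) ↔
        ∃ h : l = r * m,
          IsUnit ((SobolevBVP.charMatrix B Y).submatrix (Fin.cast h.symm) id)) := by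
  refine ⟨SobolevBVP.existsUnique_isCauchyFamily hr A, fun Y hY => ?_⟩
  rw [SobolevBVP.isInvertibleOp_bvpOp_iff_bijective,
    ← SobolevBVP.bijective_mulVec_iff_exists_isUnit]
  have h (x : Fin (r * m)) := Prod.ext_iff.1
    (SobolevBVP.isCauchyFamily_iff.1 hY (finProdFinEquiv.symm x).1 (finProdFinEquiv.symm x).2)
  exact SobolevBVP.bijective_prod_iff_bijective_mulVec
    (SobolevBVP.bijective_diffOp_prod_initialTrace hr A) B.toLinearMap (fun x => (h x).1)
    fun x => (h x).2.trans (by rw [Prod.mk.eta, Equiv.apply_symm_apply])
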